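/- Let $X\subseteq\mathbb R^d$ ($d\ge 1$) be closed and convex, $x_0\in X$, and let $r:\mathbb R^d\to\mathbb R$ be convex (lower semicontinuous). Let $\Xi$ be a set of data points; for a dataset $S=(\xi^1,\dots,\xi^n)\in\Xi^n$, $n\ge1$, let $F_S(x)=\frac1n\sum_{i=1}^n f(x,\xi^i)$, $\nabla F_S(x)=\frac1n\sum_{i=1}^n\nabla f(x,\xi^i)$ and $\Phi_S=F_S+r$. Assume that for every dataset $S$ the function $F_S$ is differentiable on $X$ with gradient $\nabla F_S$, that $\|\nabla F_S(x)-\nabla F_S(y)\|_2\le L\|x-y\|_2$ for $x,y\in X$, and that $\|\nabla F_S(x)\|_2\le G$ for $x\in X$, where $L,G>0$. The method DP-Prox-GD with step size $\eta=\frac1{2L}$ and $T$ iterations is $$x_{t+1}=\operatorname*{argmin}_{y\in X}\Big\{r(y)+\tfrac1{2\eta}\big\|y-\big(x_t-\eta(\nabla F_S(x_t)+b_t)\big)\big\|_2^2\Big\},\qquad 0\le t<T,$$ with independent $b_t\sim\mathcal N(0,\sigma_G^2I_d)$. For $\rho>0$ the forward-backward envelope is $$\mathcal D_{\rho}(x)=-2\rho\min_{y\in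 X}\Big\{\langle\nabla F_S(x),y-x\rangle+\tfrac{\rho}{2}\|y-x\|_2^2+r(y)-r(x)\Big\}.$$ A randomized algorithm is $(\varepsilon,\delta)$-DP if $\Pr(M(S)\in A)\le e^{\varepsilon}\Pr(M(S')\in A)+\delta$ for all measurable $A$ and all datasets $S,S'$ that differ in exactly one data point. Claim. For every $c_1>0$ there is $c_2>0$, and for every $\bar\beta\in(0,1)$ there is then $K>0$ (neither $c_2$ nor $K$ depends on anything but $c_1$, respectively $c_1,c_2,\bar\beta$), such that the following holds in the above setting for all $\varepsilon>0$, $\delta\in(0,1)$ with $\varepsilon\le c_1\log(1/\delta)$, all $\beta\in(0,\bar\beta]$ and all $\lambda_0\ge0$. Let $T\ge1$ be an integer with $$\left|T-\frac{n\varepsilon\sqrt{L\lambda_0}}{G\sqrt{d\log(1/\delta)\log(1/\beta)}}\right|\le1,\qquad\text{and let}\qquad \sigma_G^2=c_2\,\frac{G^2T\log(1/\delta)}{n^2\varepsilon^2}.$$ Then DP-Prox-GD, with the whole trajectory $(x_0,\dots,x_T)$ as its output, is $(\varepsilon,\delta)$-DP. Moreover, for every dataset $S$ with $\Phi_S^*:=\inf_X\Phi_S>-\infty$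 and $\Phi_S(x_0)-\Phi_S^*\le\lambda_0$ (in particular when $\lambda_0=\Phi_S(x_0)-\Phi_S^*$), with probability at least $1-\beta$, $$\frac1T\sum_{t=0}^{T-1}\mathcal D_{5L}(x_t)\le K\,\frac{G\sqrt{L\lambda_0\,d\log(1/\delta)\log(1/\beta)}}{n\varepsilon}.$$ -/

import Mathlib

open MeasureTheory ProbabilityTheory

noncomputable section

/-- The empirical loss `F_S(x) = (1/n) ∑ᵢ f(x, ξⁱ)` of a dataset `S = (ξ¹, …, ξⁿ)`. -/
def empLoss {d n : ℕ} {Ξ : Type*} (f : EuclideanSpace ℝ (Fin d) → Ξ → ℝ) (S : Fin n → Ξ)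
    (x : EuclideanSpace ℝ (Fin d)) : ℝ :=
  (1 / (n : ℝ)) * ∑ i, f x (S i)

/-- The empirical gradient `∇F_S(x) = (1/n) ∑ᵢ ∇f(x, ξⁱ)`. -/
def empGrad {d n : ℕ} {Ξ : Type*}
    (gradf : EuclideanSpace ℝ (Fin d) → Ξ → EuclideanSpace ℝ (Fin d)) (S : Fin n → Ξ)
    (x : EuclideanSpace ℝ (Fin d)) : EuclideanSpace ℝ (Fin d) :=
  (1 / (n : ℝ)) • ∑ i, gradf x (S i)

/-- The optimality gap `Φ(x) - Φ^*` over `X`, where `Φ = F + r` and `Φ^* = inf_X Φ`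
(used only when `Φ` is bounded below on `X`). -/
def optGap {d : ℕ} (X : Set (EuclideanSpace ℝ (Fin d))) (F r : EuclideanSpace ℝ (Fin d) → ℝ)
    (x : EuclideanSpace ℝ (Fin d)) : ℝ :=
  (F x + r x) - sInf ((fun y => F y + r y) '' X)

/-- `prox_{η r}(z) = argmin_{y ∈ X} r(y) + ‖y - z‖² / (2η)`. The minimizer exists and is unique
for `η > 0`, `r` convex and finite on the whole space, and `X` nonempty, closed and convex. -/
def proxMap {d : ℕ} (X : Set (EuclideanSpace ℝ (Fin d))) (r : EuclideanSpace ℝ (Fin d) → ℝ)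
    (η : ℝ) (z : EuclideanSpace ℝ (Fin d)) : EuclideanSpace ℝ (Fin d) :=
  Classical.epsilon fun y => y ∈ X ∧ IsMinOn (fun y => r y + 1 / (2 * η) * ‖y - z‖ ^ 2) X y

/-- The Euclidean forward-backward envelope `D_ρ(x) = -2ρ inf_{y ∈ X} Q_ρ(x, y)`, where
`Q_ρ(x, y) = ⟨g, y - x⟩ + (ρ/2)‖y - x‖² + r(y) - r(x)` and `g = ∇F(x)`. -/
def fbEnvelope {d : ℕ} (X : Set (EuclideanSpace ℝ (Fin d)))
    (gradF : EuclideanSpace ℝ (Fin d) → EuclideanSpace ℝ (Fin d))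
    (r : EuclideanSpace ℝ (Fin d) → ℝ) (ρ : ℝ) (x : EuclideanSpace ℝ (Fin d)) : ℝ :=
  -(2 * ρ) * sInf ((fun y => inner ℝ (gradF x) (y - x) + ρ * (1 / 2 * ‖y - x‖ ^ 2)
    + r y - r x) '' X)

/-- The iterates `x_{t+1} = prox_{η r}(x_t - η (∇F(x_t) + b_t))` driven by the noise
vectors `b_t`. -/
def proxGDIter {d : ℕ} (X : Set (EuclideanSpace ℝ (Fin d)))
    (gradF : EuclideanSpace ℝ (Fin d) → EuclideanSpace ℝ (Fin d))
    (r : EuclideanSpace ℝ (Fin d) → ℝ) (η : ℝ) (x₀ : EuclideanSpace ℝ (Fin d))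
    (b : ℕ → EuclideanSpace ℝ (Fin d)) : ℕ → EuclideanSpace ℝ (Fin d)
  | 0 => x₀
  | t + 1 =>
    proxMap X r η (proxGDIter X gradF r η x₀ b t
      - η • (gradF (proxGDIter X gradF r η x₀ b t) + b t))

/-- The trajectory `(x_0, …, x_T)` as a function of the noise `(b_0, …, b_{T-1})`. -/
def proxGDTraj {d : ℕ} (X : Set (EuclideanSpace ℝ (Fin d)))
    (gradF : EuclideanSpace ℝ (Fin d) → EuclideanSpace ℝ (Fin d))
    (r : EuclideanSpace ℝ (Fin d) → ℝ) (η : ℝ) (x₀ : EuclideanSpace ℝ (Fin d)) (T : ℕ)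
    (b : Fin T → EuclideanSpace ℝ (Fin d)) : Fin (T + 1) → EuclideanSpace ℝ (Fin d) :=
  fun t => proxGDIter X gradF r η x₀ (fun s => if h : s < T then b ⟨s, h⟩ else 0) t

/-- The law of `T` independent noise vectors `b_t ∼ N(0, v I_d)`; `v` is the variance of each
coordinate. -/
def gaussNoise (d T : ℕ) (v : ℝ) : Measure (Fin T → EuclideanSpace ℝ (Fin d)) :=
  Measure.pi fun _ => multivariateGaussian 0 (v • (1 : Matrix (Fin d) (Fin d) ℝ))

/-- The noise level `σ_G² = c G² T log(1/δ) / (n² ε²)`. -/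
def noiseVar (c G ε δ : ℝ) (n T : ℕ) : ℝ :=
  c * (G ^ 2 * T * Real.log (1 / δ) / ((n : ℝ) ^ 2 * ε ^ 2))

/-- `(ε, δ)`-differential privacy of a randomized algorithm `M` whose internal randomness has
law `P`: on input `S` and randomness `w` it outputs `M S w`. Neighbouring datasets differ in
exactly one data point. -/
def IsDP {n : ℕ} {Ξ W Y : Type*} [MeasurableSpace W] [MeasurableSpace Y] (P : Measure W)
    (M : (Fin n → Ξ) → W → Y) (ε δ : ℝ) : Prop :=
  ∀ S S' : Fin n → Ξ, (∃ i, S i ≠ S' i ∧ ∀ j, j ≠ i → S j = S' j) →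
    ∀ A : Set Y, MeasurableSet A →
      P {w | M S w ∈ A} ≤ ENNReal.ofReal (Real.exp ε) * P {w | M S' w ∈ A} + ENNReal.ofReal δ

end

/-! Privacy is Rényi composition in integral form. Changing one data point moves the gradient by at
most `Δ = 2G/n`, so a step on `S` is a step on `S'` with the noise translated by a vector of length
at most `Δ`. The Gaussian density ratio and Hölder with conjugate exponents `p`, `q` bound the
effect of a translation (`lintegral_multivariateGaussian_shift_le`). Induction on the steps
(`lintegral_proxGDTraj_le`) gives `P(A) ≤ exp((p-1)a) P'(A)^(1/q)` with `a = TΔ²/(2σ²)`, and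
`exp_mul_rpow_le` turns this into an `(ε, δ)` bound.

Utility is pathwise. The descent lemma, strong convexity of the proximal objective and Young's
inequality give `D(x_t) ≤ 10L(Φ(x_t) - Φ(x_{t+1})) + (5/2)‖b_t‖²` (`fbEnvelope_le_decrease`). The
sum telescopes, and only `∑‖b_t‖²` is random. A Chernoff bound for this chi-square variable supplies
the probability `1 - β`, and the prescribed `T` balances the two terms. If `T = 1` the noise term
need not be comparable to the rate, but then only the deterministic `x_0` is averaged. -/

/-! ### Gaussian integrals: translation bounds and the chi-square tail. -/

theorem lintegral_pi_fin_succ {α : Type*} [MeasurableSpace α] (μ : Measure α) [SigmaFinite μ]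
    (n : ℕ) {φ : (Fin (n + 1) → α) → ENNReal} (hφ : Measurable φ) :
    ∫⁻ x, φ x ∂Measure.pi (fun _ : Fin (n + 1) => μ)
      = ∫⁻ a, ∫⁻ x, φ (Fin.cons a x) ∂Measure.pi (fun _ : Fin n => μ) ∂μ := by
  have h := (measurePreserving_piFinSuccAbove (fun _ : Fin (n + 1) => μ) 0).symm
  rw [← h.lintegral_comp hφ, lintegral_prod]
  · simp [MeasurableEquiv.piFinSuccAbove_symm_apply, Fin.insertNthEquiv]
  · exact (hφ.comp (MeasurableEquiv.measurable _)).aemeasurable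

theorem measurable_fin_cons {α : Type*} [MeasurableSpace α] (n : ℕ) :
    Measurable (fun p : α × (Fin n → α) => (Fin.cons p.1 p.2 : Fin (n + 1) → α)) := by
  refine measurable_pi_lambda _ fun i => ?_
  refine Fin.cases ?_ (fun j => ?_) i
  · simpa using measurable_fst
  · simp only [Fin.cons_succ]
    fun_prop

theorem lintegral_pi_prod {α : Type*} [MeasurableSpace α] (μ : Measure α) [SigmaFinite μ]
    (n : ℕ) {φ : α → ENNReal} (hφ : Measurable φ) :
    ∫⁻ x, ∏ i, φ (x i) ∂Measure.pi (fun _ : Fin n => μ) = (∫⁻ a, φ a ∂μ) ^ n := by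
  induction n with
  | zero => simp
  | succ n ih =>
    rw [lintegral_pi_fin_succ μ n (by fun_prop)]
    simp only [Fin.prod_univ_succ, Fin.cons_zero, Fin.cons_succ]
    have (a : α) : ∫⁻ x, φ a * ∏ i, φ (x i) ∂Measure.pi (fun _ : Fin n => μ)
        = φ a * (∫⁻ a, φ a ∂μ) ^ n := by
      rw [lintegral_const_mul _ (by fun_prop), ih]
    simp_rw [this]
    rw [lintegral_mul_const _ hφ, pow_succ, mul_comm]

theorem lintegral_gaussianReal_zero {v : NNReal} (hv : v ≠ 0) (m : ℝ) {φ : ℝ → ENNReal}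
    (hφ : Measurable φ) :
    ∫⁻ x, φ x ∂gaussianReal m v = ∫⁻ x, gaussianPDF m v x * φ x := by
  rw [gaussianReal_of_var_ne_zero _ hv,
    lintegral_withDensity_eq_lintegral_mul _ (measurable_gaussianPDF m v) hφ]
  rfl

/-- Cameron–Martin in dimension one: the weight is the ratio of the densities of `N(h, v)` and `N(0,
v)`. -/
theorem lintegral_gaussianReal_shift {v : NNReal} (hv : v ≠ 0) (h : ℝ) {φ : ℝ → ENNReal}
    (hφ : Measurable φ) :
    ∫⁻ x, φ (x + h) ∂gaussianReal 0 v
      = ∫⁻ x, ENNReal.ofReal (Real.exp (h / v * x - h ^ 2 / (2 * v))) * φ x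
          ∂gaussianReal 0 v := by
  have hm : ∫⁻ x, φ (x + h) ∂gaussianReal 0 v = ∫⁻ x, φ x ∂gaussianReal h v := by
    have := gaussianReal_map_add_const (μ := 0) (v := v) h
    rw [zero_add] at this
    rw [← this, lintegral_map hφ (by fun_prop)]
  rw [hm, lintegral_gaussianReal_zero hv _ hφ,
    lintegral_gaussianReal_zero hv _ (by fun_prop)]
  refine lintegral_congr fun x => ?_
  rw [← mul_assoc]
  congr 1
  have hv' : (v : ℝ) ≠ 0 := by exact_mod_cast hv
  rw [gaussianPDF, gaussianPDF, ← ENNReal.ofReal_mul (gaussianPDFReal_nonneg _ _ _),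
    gaussianPDFReal, gaussianPDFReal, mul_assoc (√_)⁻¹, ← Real.exp_add]
  congr 3
  field_simp
  ring

theorem lintegral_exp_gaussianReal (v : NNReal) (t s : ℝ) :
    ∫⁻ x, ENNReal.ofReal (Real.exp (t * x - s)) ∂gaussianReal 0 v
      = ENNReal.ofReal (Real.exp (v * t ^ 2 / 2 - s)) := by
  have hi := (integrable_exp_mul_gaussianReal (μ := 0) (v := v) t).mul_const (Real.exp (-s))
  have hm := congrFun (mgf_id_gaussianReal (μ := 0) (v := v)) t
  simp only [mgf, id, zero_mul, zero_add] at hm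
  simp_rw [sub_eq_add_neg, Real.exp_add]
  rw [← ofReal_integral_eq_lintegral_ofReal hi
    (Filter.Eventually.of_forall fun x => by positivity), integral_mul_const, hm]

/-- Hölder separates the density ratio from `φ`; the `p`-norm of the ratio is an explicit Gaussian
exponential moment. -/
theorem lintegral_gaussianReal_shift_le {v : NNReal} (hv : v ≠ 0) {p q : ℝ}
    (hpq : p.HolderConjugate q) (h : ℝ) {φ : ℝ → ENNReal} (hφ : Measurable φ) :
    ∫⁻ x, φ (x + h) ∂gaussianReal 0 v
      ≤ ENNReal.ofReal (Real.exp ((p - 1) / (2 * v) * h ^ 2))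
        * (∫⁻ x, φ x ^ q ∂gaussianReal 0 v) ^ (1 / q) := by
  rw [lintegral_gaussianReal_shift hv h hφ]
  refine (ENNReal.lintegral_mul_le_Lp_mul_Lq _ hpq (by fun_prop) hφ.aemeasurable).trans_eq ?_
  congr 1
  have hp := hpq.pos
  have hv' : (v : ℝ) ≠ 0 := by exact_mod_cast hv
  have (x : ℝ) : ENNReal.ofReal (Real.exp (h / v * x - h ^ 2 / (2 * v))) ^ p
      = ENNReal.ofReal (Real.exp (p * h / v * x - p * h ^ 2 / (2 * v))) := by
    rw [ENNReal.ofReal_rpow_of_pos (Real.exp_pos _), ← Real.exp_mul]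
    congr 2
    ring
  simp_rw [this]
  rw [lintegral_exp_gaussianReal, ENNReal.ofReal_rpow_of_pos (Real.exp_pos _), ← Real.exp_mul]
  congr 2
  field_simp

/-- The weight halves the exponent of the density, leaving `√2` times the density of `N(0, 2v)`. -/
theorem lintegral_exp_sq_gaussianReal {v : NNReal} (hv : v ≠ 0) :
    ∫⁻ x, ENNReal.ofReal (Real.exp (x ^ 2 / (4 * v))) ∂gaussianReal 0 v
      = ENNReal.ofReal √2 := by
  rw [lintegral_gaussianReal_zero hv _ (by fun_prop)]
  have hv' : (v : ℝ) ≠ 0 := by exact_mod_cast hv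
  have (x : ℝ) : gaussianPDF 0 v x * ENNReal.ofReal (Real.exp (x ^ 2 / (4 * v)))
      = ENNReal.ofReal √2 * gaussianPDF 0 (2 * v) x := by
    rw [gaussianPDF, gaussianPDF, ← ENNReal.ofReal_mul (gaussianPDFReal_nonneg _ _ _),
      ← ENNReal.ofReal_mul (Real.sqrt_nonneg _), gaussianPDFReal, gaussianPDFReal, mul_assoc,
      ← Real.exp_add, ← mul_assoc]
    congr 2
    · rw [NNReal.coe_mul, NNReal.coe_ofNat, mul_left_comm, Real.sqrt_mul (by norm_num) (_ * _),
        mul_inv, ← mul_assoc, mul_inv_cancel₀ (by positivity), one_mul]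
    · congr 1
      push_cast
      field_simp
      ring
  simp_rw [this]
  rw [lintegral_const_mul _ (measurable_gaussianPDF _ _),
    lintegral_gaussianPDF_eq_one _ (by simpa using hv), mul_one]

theorem multivariateGaussian_smul_one (d : ℕ) {v : ℝ} (hv : 0 ≤ v) :
    multivariateGaussian 0 (v • (1 : Matrix (Fin d) (Fin d) ℝ))
      = (Measure.pi fun _ : Fin d => gaussianReal 0 v.toNNReal).map (WithLp.toLp 2) := by
  have hS : (v • (1 : Matrix (Fin d) (Fin d) ℝ)).PosSemidef := Matrix.PosSemidef.one.smul hv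
  apply Measure.ext_of_charFun
  ext t
  rw [charFun_multivariateGaussian hS, charFun_pi]
  simp_rw [charFun_gaussianReal, ← Complex.exp_sum]
  congr 1
  simp [Matrix.smul_mulVec, Matrix.one_mulVec, dotProduct, hv, Finset.sum_div]
  refine Finset.sum_congr rfl fun i _ => ?_
  ring

/-- Tensorization, one coordinate at a time: the inner bound produces a `1/q`-th power, which the
`q`-th power from the outer bound cancels, so the constants simply multiply. -/
theorem lintegral_pi_gaussianReal_shift_le {v : NNReal} (hv : v ≠ 0) {p q : ℝ}
    (hpq : p.HolderConjugate q) (d : ℕ) (h : Fin d → ℝ) {φ : (Fin d → ℝ) → ENNReal}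
    (hφ : Measurable φ) :
    ∫⁻ x, φ (x + h) ∂Measure.pi (fun _ => gaussianReal 0 v)
      ≤ ENNReal.ofReal (Real.exp ((p - 1) / (2 * v) * ∑ i, h i ^ 2))
        * (∫⁻ x, φ x ^ q ∂Measure.pi (fun _ => gaussianReal 0 v)) ^ (1 / q) := by
  have hq := hpq.symm.pos
  induction d with
  | zero =>
    have h0 : ∀ x : Fin 0 → ℝ, x = h := fun x => Subsingleton.elim _ _
    simp [← ENNReal.rpow_mul, hq.ne', h0]
  | succ d ih =>
    have hc := measurable_fin_cons (α := ℝ) d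
    have hψ : Measurable fun a => (∫⁻ x, φ (Fin.cons a x) ^ q
        ∂Measure.pi (fun _ : Fin d => gaussianReal 0 v)) ^ (1 / q) :=
      (Measurable.lintegral_prod_right' (f := fun p : ℝ × (Fin d → ℝ) => φ (Fin.cons p.1 p.2) ^ q)
        ((hφ.comp hc).pow_const q)).pow_const _
    rw [lintegral_pi_fin_succ _ _ (φ := fun x => φ (x + h)) (hφ.comp (measurable_id.add_const h)),
      lintegral_pi_fin_succ _ _ (hφ.pow_const q)]
    set c := ENNReal.ofReal (Real.exp ((p - 1) / (2 * v) * ∑ i : Fin d, h i.succ ^ 2))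
    calc _ ≤ ∫⁻ a, c * (∫⁻ x, φ (Fin.cons (a + h 0) x) ^ q
            ∂Measure.pi (fun _ : Fin d => gaussianReal 0 v)) ^ (1 / q) ∂gaussianReal 0 v := by
          refine lintegral_mono fun a => ?_
          have := ih (fun i => h i.succ) (φ := fun x => φ (Fin.cons (a + h 0) x))
            (hφ.comp (hc.comp (measurable_const.prodMk measurable_id)))
          refine le_of_eq_of_le (lintegral_congr fun x => ?_) this
          congr 1
          ext i
          refine Fin.cases ?_ (fun j => ?_) i <;> simp
      _ ≤ _ := by
          refine (lintegral_const_mul c (hψ.comp (measurable_id.add_const (h 0)))).trans_le ?_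
          refine (mul_le_mul_right
            (lintegral_gaussianReal_shift_le hv hpq (h 0) hψ) c).trans_eq ?_
          rw [← mul_assoc, ← ENNReal.ofReal_mul (Real.exp_nonneg _), ← Real.exp_add,
            Fin.sum_univ_succ]
          simp_rw [← ENNReal.rpow_mul, one_div_mul_cancel hq.ne', ENNReal.rpow_one]
          congr 3
          ring

theorem lintegral_multivariateGaussian_shift_le {d : ℕ} {v : ℝ} (hv : 0 < v) {p q : ℝ}
    (hpq : p.HolderConjugate q) (h : EuclideanSpace ℝ (Fin d))
    {φ : EuclideanSpace ℝ (Fin d) → ENNReal} (hφ : Measurable φ) :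
    ∫⁻ x, φ (x + h) ∂multivariateGaussian 0 (v • (1 : Matrix (Fin d) (Fin d) ℝ))
      ≤ ENNReal.ofReal (Real.exp ((p - 1) / (2 * v) * ‖h‖ ^ 2))
        * (∫⁻ x, φ x ^ q ∂multivariateGaussian 0 (v • (1 : Matrix (Fin d) (Fin d) ℝ)))
          ^ (1 / q) := by
  have hm : Measurable (WithLp.toLp 2 : (Fin d → ℝ) → EuclideanSpace ℝ (Fin d)) := by fun_prop
  rw [multivariateGaussian_smul_one d hv.le, lintegral_map (by fun_prop) hm,
    lintegral_map (by fun_prop) hm]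
  have := lintegral_pi_gaussianReal_shift_le (v := v.toNNReal) (by simpa using hv) hpq d h.ofLp
    (φ := fun x => φ (WithLp.toLp 2 x)) (hφ.comp hm)
  rw [Real.coe_toNNReal _ hv.le] at this
  rw [EuclideanSpace.real_norm_sq_eq]
  exact this

theorem lintegral_exp_norm_sq_multivariateGaussian (d : ℕ) {v : ℝ} (hv : 0 < v) :
    ∫⁻ x, ENNReal.ofReal (Real.exp (‖x‖ ^ 2 / (4 * v)))
        ∂multivariateGaussian 0 (v • (1 : Matrix (Fin d) (Fin d) ℝ))
      = ENNReal.ofReal √2 ^ d := by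
  have hm : Measurable (WithLp.toLp 2 : (Fin d → ℝ) → EuclideanSpace ℝ (Fin d)) := by fun_prop
  rw [multivariateGaussian_smul_one d hv.le, lintegral_map (by fun_prop) hm,
    ← lintegral_exp_sq_gaussianReal (v := v.toNNReal) (by simpa using hv),
    ← lintegral_pi_prod _ d (by fun_prop)]
  refine lintegral_congr fun x => ?_
  rw [EuclideanSpace.real_norm_sq_eq, Finset.sum_div, Real.exp_sum,
    ENNReal.ofReal_prod_of_nonneg fun _ _ => Real.exp_nonneg _, Real.coe_toNNReal _ hv.le]

/-- Markov's inequality for `exp(∑‖b_t‖²/(4v))`, whose integral factors over steps and coordinates.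
-/
theorem gaussNoise_sum_norm_sq_ge_le (d T : ℕ) {v : ℝ} (hv : 0 < v) (s : ℝ) :
    gaussNoise d T v {b | s ≤ ∑ t, ‖b t‖ ^ 2}
      ≤ ENNReal.ofReal (√2 ^ (d * T) * Real.exp (-(s / (4 * v)))) := by
  have key : ∫⁻ b, ENNReal.ofReal (Real.exp ((∑ t, ‖b t‖ ^ 2) / (4 * v))) ∂gaussNoise d T v
      = ENNReal.ofReal (√2 ^ (d * T)) := by
    rw [ENNReal.ofReal_pow (Real.sqrt_nonneg _), pow_mul,
      ← lintegral_exp_norm_sq_multivariateGaussian d hv,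
      ← lintegral_pi_prod _ T (by fun_prop)]
    refine lintegral_congr fun x => ?_
    rw [Finset.sum_div, Real.exp_sum, ENNReal.ofReal_prod_of_nonneg fun _ _ => Real.exp_nonneg _]
  have hpos : ENNReal.ofReal (Real.exp (s / (4 * v))) ≠ 0 := by simp [Real.exp_pos]
  have := meas_ge_le_lintegral_div (μ := gaussNoise d T v)
    (f := fun b => ENNReal.ofReal (Real.exp ((∑ t, ‖b t‖ ^ 2) / (4 * v))))
    (Measurable.aemeasurable (by fun_prop)) hpos ENNReal.ofReal_ne_top
  rw [key] at this
  refine (measure_mono fun b hb => ?_).trans (this.trans_eq ?_)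
  · refine ENNReal.ofReal_le_ofReal (Real.exp_le_exp.2 ?_)
    exact div_le_div_of_nonneg_right hb (by positivity)
  · rw [← ENNReal.ofReal_div_of_pos (Real.exp_pos _), Real.exp_neg, div_eq_mul_inv]

/-! ### The proximal map: existence, strong convexity, nonexpansiveness. -/

section Prox

variable {d : ℕ} {X : Set (EuclideanSpace ℝ (Fin d))} {r : EuclideanSpace ℝ (Fin d) → ℝ} {η : ℝ}

theorem exists_isMinOn_prox (hX : IsClosed X) (hne : X.Nonempty) (hr : ConvexOn ℝ Set.univ r)
    (hη : 0 < η) (z : EuclideanSpace ℝ (Fin d)) :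
    ∃ y, y ∈ X ∧ IsMinOn (fun y => r y + 1 / (2 * η) * ‖y - z‖ ^ 2) X y := by
  obtain ⟨x₀, hx₀⟩ := hne
  have hrc : Continuous r := hr.locallyLipschitz.continuous
  set k := 1 / (2 * η) with hk
  have hk0 : 0 < k := by positivity
  obtain ⟨m, -, hm⟩ := (isCompact_closedBall z 1).exists_isMinOn
    ⟨z, Metric.mem_closedBall_self zero_le_one⟩ hrc.continuousOn
  have hmz : r m ≤ r z := hm (Metric.mem_closedBall_self zero_le_one)
  -- Convexity on the segment from `z` to `y`, compared with the minimum of `r` on the unit ball,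
  -- shows that `r` decreases at most linearly. The quadratic term therefore wins outside the radius
  -- `R` below.
  have hlow : ∀ y, 1 ≤ ‖y - z‖ → r z - (r z - r m) * ‖y - z‖ ≤ r y := by
    intro y hy
    set t := ‖y - z‖
    have ht : 0 < t := by linarith
    have hw : (1 - t⁻¹) • z + t⁻¹ • y ∈ Metric.closedBall z 1 := by
      rw [mem_closedBall_iff_norm,
        show (1 - t⁻¹) • z + t⁻¹ • y - z = t⁻¹ • (y - z) by module, norm_smul,
        Real.norm_of_nonneg (by positivity)]
      exact (inv_mul_cancel₀ ht.ne').le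
    have h1 : r m ≤ _ := hm hw
    have h2 := hr.2 (Set.mem_univ z) (Set.mem_univ y) 
      (sub_nonneg.2 (inv_le_one_of_one_le₀ hy)) (inv_nonneg.2 ht.le) (sub_add_cancel 1 t⁻¹)
    simp only [smul_eq_mul] at h2
    have h3 : t * r m ≤ t * ((1 - t⁻¹) * r z + t⁻¹ * r y) :=
      mul_le_mul_of_nonneg_left (h1.trans h2) ht.le
    have h4 : t * ((1 - t⁻¹) * r z + t⁻¹ * r y) = t * r z - r z + r y := by
      field_simp
    nlinarith
  set D := |r x₀ + k * ‖x₀ - z‖ ^ 2 - r z|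
  set R := 1 + (r z - r m + D) / k
  have hcont : ContinuousOn (fun y => r y + k * ‖y - z‖ ^ 2) X :=
    (hrc.add (by fun_prop)).continuousOn
  refine hcont.exists_isMinOn' hX hx₀ (Filter.Eventually.filter_mono inf_le_left ?_)
  filter_upwards [(isCompact_closedBall z R).compl_mem_cocompact] with y hy
  have hy' : R < ‖y - z‖ := by simpa [dist_eq_norm] using hy
  have hD : 0 ≤ D := abs_nonneg _
  have hD' : r x₀ + k * ‖x₀ - z‖ ^ 2 - r z ≤ D := le_abs_self _
  have hR : 1 ≤ R := by
    have : 0 ≤ (r z - r m + D) / k := by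
      apply div_nonneg _ hk0.le
      linarith
    linarith
  have hkR : k * R = k + (r z - r m + D) := by
    simp only [R]
    field_simp
  have h1 := hlow y (by linarith)
  have h2 : k * R ≤ k * ‖y - z‖ := by gcongr
  have h3 : 0 ≤ (‖y - z‖ - 1) * (k * ‖y - z‖ - (r z - r m)) :=
    mul_nonneg (by linarith) (by linarith)
  nlinarith

theorem proxMap_mem (hX : IsClosed X) (hne : X.Nonempty) (hr : ConvexOn ℝ Set.univ r)
    (hη : 0 < η) (z : EuclideanSpace ℝ (Fin d)) : proxMap X r η z ∈ X :=
  (Classical.epsilon_spec (exists_isMinOn_prox hX hne hr hη z)).1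

/-- The minimized function is strongly convex, so it grows quadratically away from the
proximal point. -/
theorem proxMap_add_sq_le (hX : IsClosed X) (hXc : Convex ℝ X) (hr : ConvexOn ℝ Set.univ r)
    (hη : 0 < η) (z : EuclideanSpace ℝ (Fin d)) {y : EuclideanSpace ℝ (Fin d)} (hy : y ∈ X) :
    r (proxMap X r η z) + 1 / (2 * η) * ‖proxMap X r η z - z‖ ^ 2
        + 1 / (2 * η) * ‖y - proxMap X r η z‖ ^ 2
      ≤ r y + 1 / (2 * η) * ‖y - z‖ ^ 2 := by
  obtain ⟨hp, hmin⟩ : proxMap X r η z ∈ X ∧ IsMinOn _ X (proxMap X r η z) :=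
    Classical.epsilon_spec (exists_isMinOn_prox hX ⟨y, hy⟩ hr hη z)
  set p := proxMap X r η z
  set k := 1 / (2 * η) with hk
  have hk0 : 0 < k := by positivity
  set A := r y - r p + 2 * k * inner ℝ (p - z) (y - p) with hA
  set B := k * ‖y - p‖ ^ 2 with hB
  have hB0 : 0 ≤ B := by positivity
  have hexp : ∀ t : ℝ, ‖p + t • (y - p) - z‖ ^ 2
      = ‖p - z‖ ^ 2 + 2 * t * inner ℝ (p - z) (y - p) + t ^ 2 * ‖y - p‖ ^ 2 := by
    intro t
    rw [show p + t • (y - p) - z = (p - z) + t • (y - p) by abel, norm_add_sq_real,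
      real_inner_smul_right, norm_smul, mul_pow, Real.norm_eq_abs, sq_abs]
    ring
  have hline : ∀ t : ℝ, 0 < t → t ≤ 1 → 0 ≤ A + t * B := by
    intro t ht ht1
    have hw : p + t • (y - p) ∈ X := hXc.add_smul_sub_mem hp hy ⟨ht.le, ht1⟩
    have h1 := hmin hw
    have h2 := hr.2 (Set.mem_univ p) (Set.mem_univ y) 
      (sub_nonneg.2 ht1) ht.le (sub_add_cancel 1 t)
    rw [show (1 - t) • p + t • y = p + t • (y - p) by module] at h2
    simp only [smul_eq_mul, Set.mem_ofPred_eq] at h1 h2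
    rw [hexp t] at h1
    have h3 : 0 ≤ t * (A + t * B) := by
      rw [hA, hB]
      linarith
    exact nonneg_of_mul_nonneg_right h3 ht
  -- `A ≥ 0` is a rearrangement of the claim. It is the limit of `A + t * B ≥ 0` as `t → 0`; if `A <
  -- 0`, the explicit `t` below already makes the expression negative.
  have hA0 : 0 ≤ A := by
    by_contra! hneg
    have hBA : 0 < B - A := by linarith
    have h := hline (-A / (B - A)) (div_pos (by linarith) hBA) ((div_le_one hBA).2 (by linarith))
    have h1 : A + -A / (B - A) * B = -(A ^ 2 / (B - A)) := by
      field_simp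
      ring
    have h2 : 0 < A ^ 2 / (B - A) := div_pos (by nlinarith) hBA
    linarith
  have h1 := hexp 1
  rw [one_smul, show p + (y - p) - z = y - z by abel] at h1
  rw [h1]
  linarith

/-- Adding the growth inequalities at the two proximal points gives `‖p - q‖² ≤ ⟨p - q, z - w⟩`;
Cauchy–Schwarz finishes. -/
theorem norm_proxMap_sub_le (hX : IsClosed X) (hXc : Convex ℝ X) (hne : X.Nonempty)
    (hr : ConvexOn ℝ Set.univ r) (hη : 0 < η) (z w : EuclideanSpace ℝ (Fin d)) :
    ‖proxMap X r η z - proxMap X r η w‖ ≤ ‖z - w‖ := by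
  have h1 := proxMap_add_sq_le hX hXc hr hη z (proxMap_mem hX hne hr hη w)
  have h2 := proxMap_add_sq_le hX hXc hr hη w (proxMap_mem hX hne hr hη z)
  set p := proxMap X r η z
  set q := proxMap X r η w
  set k := 1 / (2 * η)
  have hk0 : 0 < k := by positivity
  have e1 : ‖q - z‖ ^ 2 + ‖p - w‖ ^ 2 - ‖p - z‖ ^ 2 - ‖q - w‖ ^ 2
      = 2 * inner ℝ (p - q) (z - w) := by
    simp only [norm_sub_sq_real, inner_sub_left, inner_sub_right]
    ring
  rw [norm_sub_rev q p] at h1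
  have h3 : k * ‖p - q‖ ^ 2 ≤ k * inner ℝ (p - q) (z - w) := by
    have : k * _ = k * _ := congrArg (k * ·) e1
    nlinarith
  have h4 := le_of_mul_le_mul_left h3 hk0
  have h5 := real_inner_le_norm (p - q) (z - w)
  rcases (norm_nonneg (p - q)).eq_or_lt with h | h
  · rw [← h]
    exact norm_nonneg _
  · nlinarith

theorem continuous_proxMap (hX : IsClosed X) (hXc : Convex ℝ X) (hne : X.Nonempty)
    (hr : ConvexOn ℝ Set.univ r) (hη : 0 < η) : Continuous (proxMap X r η) :=
  (LipschitzWith.of_dist_le_mul (K := 1) fun z w => by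
    simpa [dist_eq_norm] using norm_proxMap_sub_le hX hXc hne hr hη z w).continuous

/-- The projection onto `X`, obtained as the proximal map of `0`. It serves to extend gradients that
are controlled only on `X` to continuous fields on the whole space. -/
theorem exists_continuous_retraction (hX : IsClosed X) (hXc : Convex ℝ X) (hne : X.Nonempty) :
    ∃ P : EuclideanSpace ℝ (Fin d) → EuclideanSpace ℝ (Fin d),
      Continuous P ∧ (∀ x, P x ∈ X) ∧ ∀ x ∈ X, P x = x := by
  have h0 : ConvexOn ℝ Set.univ (fun _ : EuclideanSpace ℝ (Fin d) => (0 : ℝ)) :=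
    convexOn_const 0 convex_univ
  refine ⟨proxMap X (fun _ => 0) 1, continuous_proxMap hX hXc hne h0 one_pos,
    proxMap_mem hX hne h0 one_pos, fun x hx => ?_⟩
  have h := proxMap_add_sq_le hX hXc h0 one_pos x hx
  simp only [sub_self, norm_zero] at h
  have : ‖proxMap X (fun _ => 0) 1 x - x‖ ^ 2 = 0 := by
    have := sq_nonneg ‖x - proxMap X (fun _ => 0) 1 x‖
    have := sq_nonneg ‖proxMap X (fun _ => 0) 1 x - x‖
    linarith
  exact sub_eq_zero.1 (norm_eq_zero.1 (pow_eq_zero_iff two_ne_zero |>.1 this))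

end Prox

/-! ### The descent lemma and bounds on the forward-backward envelope. -/

theorem le_add_inner_add_sq_of_lipschitz_gradient {E : Type*} [NormedAddCommGroup E]
    [InnerProductSpace ℝ E] [CompleteSpace E] {X : Set E} (hX : Convex ℝ X) {F : E → ℝ}
    {g : E → E} {L : ℝ} (hF : ∀ x ∈ X, HasGradientWithinAt F (g x) X x)
    (hg : ∀ x ∈ X, ∀ y ∈ X, ‖g x - g y‖ ≤ L * ‖x - y‖) {x y : E} (hx : x ∈ X) (hy : y ∈ X) :
    F y ≤ F x + inner ℝ (g x) (y - x) + L / 2 * ‖y - x‖ ^ 2 := by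
  have hmem : ∀ t ∈ Set.Icc (0 : ℝ) 1, x + t • (y - x) ∈ X :=
    fun t ht => hX.add_smul_sub_mem hx hy ht
  have hder : ∀ t ∈ Set.Icc (0 : ℝ) 1, HasDerivWithinAt (fun t : ℝ => F (x + t • (y - x)))
      (inner ℝ (g (x + t • (y - x))) (y - x)) (Set.Icc 0 1) t := by
    intro t ht
    have hl : HasDerivWithinAt (fun t : ℝ => x + t • (y - x)) (y - x) (Set.Icc 0 1) t := by
      simpa using (((hasDerivAt_id t).smul_const (y - x)).const_add x).hasDerivWithinAt
    have := (hF _ (hmem t ht)).hasFDerivWithinAt.comp_hasDerivWithinAt t hl hmem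
    simpa [Function.comp_def] using this
  -- Along the segment, `F` starts level with the quadratic `B` and its derivative stays below `B'`,
  -- by Cauchy–Schwarz and the Lipschitz bound.
  have key := image_le_of_deriv_right_le_deriv_boundary
    (f := fun t : ℝ => F (x + t • (y - x)))
    (f' := fun t => inner ℝ (g (x + t • (y - x))) (y - x)) (a := 0) (b := 1)
    (B := fun t => F x + t * inner ℝ (g x) (y - x) + L * ‖y - x‖ ^ 2 * (t ^ 2 / 2))
    (B' := fun t => inner ℝ (g x) (y - x) + L * ‖y - x‖ ^ 2 * t)
    (fun t ht => (hder t ht).continuousWithinAt)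
    (fun t ht => (hder t ⟨ht.1, ht.2.le⟩).mono_of_mem_nhdsWithin (Icc_mem_nhdsGE_of_mem ht))
    (by simp) (by fun_prop)
    (fun t _ => by
      have h1 := ((hasDerivAt_id t).mul_const (inner ℝ (g x) (y - x))).const_add (F x)
      have h2 := (((hasDerivAt_id t).pow 2).div_const 2).const_mul (L * ‖y - x‖ ^ 2)
      refine HasDerivAt.hasDerivWithinAt ((h1.add h2).congr_deriv ?_)
      simp)
    (fun t ht => by
      have h1 := real_inner_le_norm (g (x + t • (y - x)) - g x) (y - x)
      have h2 := hg _ (hmem t ⟨ht.1, ht.2.le⟩) x hx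
      rw [add_sub_cancel_left, norm_smul, Real.norm_of_nonneg ht.1] at h2
      rw [inner_sub_left] at h1
      have h3 := mul_le_mul_of_nonneg_right h2 (norm_nonneg (y - x))
      nlinarith)
    (Set.right_mem_Icc.2 zero_le_one)
  simp only [one_smul, add_sub_cancel, one_mul, one_pow] at key
  linarith

section Envelope

variable {d : ℕ} {X : Set (EuclideanSpace ℝ (Fin d))} {r F : EuclideanSpace ℝ (Fin d) → ℝ}
  {g : EuclideanSpace ℝ (Fin d) → EuclideanSpace ℝ (Fin d)} {L : ℝ}

theorem fbEnvelope_le_of_forall_le {ρ c : ℝ} (hρ : 0 ≤ ρ) (hne : X.Nonempty)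
    {x : EuclideanSpace ℝ (Fin d)}
    (h : ∀ y ∈ X, -c ≤ inner ℝ (g x) (y - x) + ρ * (1 / 2 * ‖y - x‖ ^ 2) + r y - r x) :
    fbEnvelope X g r ρ x ≤ 2 * ρ * c := by
  have h1 : -c ≤ sInf ((fun y => inner ℝ (g x) (y - x) + ρ * (1 / 2 * ‖y - x‖ ^ 2)
      + r y - r x) '' X) :=
    le_csInf (hne.image _) (by rintro _ ⟨y, hy, rfl⟩; exact h y hy)
  have h2 := mul_le_mul_of_nonneg_left h1 (by linarith : 0 ≤ 2 * ρ)
  rw [fbEnvelope]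
  linarith

/-- Since `5L ≥ L`, the descent lemma puts the envelope's model above `Φ(y) - Φ(x)`, hence above
`Φ^* - Φ(x)`. This noise-free bound serves the case `T = 1`. -/
theorem fbEnvelope_le_optGap (hL : 0 < L) (hX : Convex ℝ X)
    (hF : ∀ x ∈ X, HasGradientWithinAt F (g x) X x)
    (hg : ∀ x ∈ X, ∀ y ∈ X, ‖g x - g y‖ ≤ L * ‖x - y‖)
    (hb : BddBelow ((fun y => F y + r y) '' X)) {x : EuclideanSpace ℝ (Fin d)} (hx : x ∈ X) :
    fbEnvelope X g r (5 * L) x ≤ 10 * L * optGap X F r x := by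
  refine (fbEnvelope_le_of_forall_le (c := optGap X F r x) (by positivity) ⟨x, hx⟩
    fun y hy => ?_).trans_eq (by ring)
  have h1 := le_add_inner_add_sq_of_lipschitz_gradient hX hF hg hx hy
  have h2 := csInf_le hb (Set.mem_image_of_mem _ hy)
  have h3 : 0 ≤ L * ‖y - x‖ ^ 2 := by positivity
  simp only [optGap] at h2 ⊢
  linarith

/-- One inexact proximal gradient step decreases the objective by the envelope, up to the squared
norm of the error. -/
theorem fbEnvelope_le_decrease (hL : 0 < L) (hXc : IsClosed X) (hX : Convex ℝ X)
    (hr : ConvexOn ℝ Set.univ r) (hF : ∀ x ∈ X, HasGradientWithinAt F (g x) X x)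
    (hg : ∀ x ∈ X, ∀ y ∈ X, ‖g x - g y‖ ≤ L * ‖x - y‖) {x x' b : EuclideanSpace ℝ (Fin d)}
    (hx : x ∈ X) (hx' : x' = proxMap X r (1 / (2 * L)) (x - (1 / (2 * L)) • (g x + b))) :
    fbEnvelope X g r (5 * L) x
      ≤ 10 * L * ((F x + r x) - (F x' + r x')) + 5 / 2 * ‖b‖ ^ 2 := by
  have hη : 0 < 1 / (2 * L) := by positivity
  refine (fbEnvelope_le_of_forall_le (c := (F x + r x) - (F x' + r x') + ‖b‖ ^ 2 / (4 * L))
    (by positivity) ⟨x, hx⟩ fun y hy => ?_).trans_eq (by field_simp; ring)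
  have hmem : x' ∈ X := hx' ▸ proxMap_mem hXc ⟨x, hx⟩ hr hη _
  have h1 := le_add_inner_add_sq_of_lipschitz_gradient hX hF hg hx hmem
  have h2 := proxMap_add_sq_le hXc hX hr hη (x - (1 / (2 * L)) • (g x + b)) hy
  rw [← hx'] at h2
  have hk : 1 / (2 * (1 / (2 * L))) = L := by field_simp
  have hexp : ∀ w, L * ‖w - (x - (1 / (2 * L)) • (g x + b))‖ ^ 2
      = L * ‖w - x‖ ^ 2 + inner ℝ (g x) (w - x) + inner ℝ b (w - x)
        + L * ‖(1 / (2 * L)) • (g x + b)‖ ^ 2 := by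
    intro w
    rw [← sub_add, norm_add_sq_real, real_inner_smul_right, real_inner_comm, inner_add_left]
    field_simp
    ring
  rw [hk, hexp x', hexp y] at h2
  have h3 : inner ℝ b (y - x) - inner ℝ b (x' - x) = inner ℝ b (y - x') := by
    rw [← inner_sub_right]
    congr 1
    abel
  -- Young's inequality, weighted so that `L * ‖y - x'‖ ^ 2` is exactly the strong convexity gain in
  -- `h2`. What remains is quadratic with coefficient `L`, below the `5L/2` of the envelope.
  have h4 : inner ℝ b (y - x') ≤ ‖b‖ ^ 2 / (4 * L) + L * ‖y - x'‖ ^ 2 := by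
    have h5 := real_inner_le_norm b (y - x')
    have h6 : ‖b‖ ^ 2 / (4 * L) + L * ‖y - x'‖ ^ 2 - ‖b‖ * ‖y - x'‖
        = (‖b‖ - 2 * L * ‖y - x'‖) ^ 2 / (4 * L) := by
      field_simp
      ring
    have h7 : 0 ≤ (‖b‖ - 2 * L * ‖y - x'‖) ^ 2 / (4 * L) := by positivity
    linarith
  have h8 : 0 ≤ L * ‖y - x‖ ^ 2 := by positivity
  have h9 : 0 ≤ L * ‖x' - x‖ ^ 2 := by positivity
  linarith

end Envelope

/-! ### The trajectory as a function of the noise, and its privacy. -/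

instance (d T : ℕ) (v : ℝ) : IsProbabilityMeasure (gaussNoise d T v) := by
  unfold gaussNoise
  infer_instance

section Trajectory

variable {d : ℕ} {X : Set (EuclideanSpace ℝ (Fin d))} {r : EuclideanSpace ℝ (Fin d) → ℝ} {η : ℝ}
  {g g' : EuclideanSpace ℝ (Fin d) → EuclideanSpace ℝ (Fin d)}

/-- The definition unfolds the last step; the privacy induction integrates over the first noise
vector, so the first step must be peeled off. -/
theorem proxGDIter_succ' (x : EuclideanSpace ℝ (Fin d)) (b : ℕ → EuclideanSpace ℝ (Fin d))
    (t : ℕ) :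
    proxGDIter X g r η x b (t + 1)
      = proxGDIter X g r η (proxMap X r η (x - η • (g x + b 0))) (fun s => b (s + 1)) t := by
  induction t with
  | zero => rfl
  | succ t ih => rw [proxGDIter, ih, proxGDIter]

theorem proxGDIter_mem (hP : ∀ z, proxMap X r η z ∈ X) {x : EuclideanSpace ℝ (Fin d)}
    (hx : x ∈ X) (b : ℕ → EuclideanSpace ℝ (Fin d)) (t : ℕ) :
    proxGDIter X g r η x b t ∈ X := by
  cases t with
  | zero => exact hx
  | succ t => exact hP _

theorem proxGDTraj_congr (hP : ∀ z, proxMap X r η z ∈ X) (hg : ∀ x ∈ X, g x = g' x)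
    {x : EuclideanSpace ℝ (Fin d)} (hx : x ∈ X) (T : ℕ) :
    proxGDTraj X g r η x T = proxGDTraj X g' r η x T := by
  have (b : ℕ → EuclideanSpace ℝ (Fin d)) (t : ℕ) :
      proxGDIter X g r η x b t = proxGDIter X g' r η x b t := by
    induction t with
    | zero => rfl
    | succ t ih =>
      rw [proxGDIter, proxGDIter, ← ih, hg _ (proxGDIter_mem hP hx b t)]
  ext b t : 2
  exact this _ _

theorem proxGDTraj_cons (x a : EuclideanSpace ℝ (Fin d)) (T : ℕ)
    (b : Fin T → EuclideanSpace ℝ (Fin d)) :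
    proxGDTraj X g r η x (T + 1) (Fin.cons a b)
      = Fin.cons x (proxGDTraj X g r η (proxMap X r η (x - η • (g x + a))) T b) := by
  ext t : 1
  refine Fin.cases rfl (fun j => ?_) t
  simp only [proxGDTraj, Fin.val_succ, Fin.cons_succ, proxGDIter_succ']
  congr 1
  ext s : 1
  by_cases h : s < T
  · simp only [h, add_lt_add_iff_right, dif_pos]
    exact Fin.cons_succ (α := fun _ => EuclideanSpace ℝ (Fin d)) a b ⟨s, h⟩
  · simp [h]

theorem continuous_proxGDTraj (hP : Continuous (proxMap X r η)) (hg : Continuous g) (T : ℕ) :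
    Continuous fun p : EuclideanSpace ℝ (Fin d) × (Fin T → EuclideanSpace ℝ (Fin d)) =>
      proxGDTraj X g r η p.1 T p.2 := by
  have key (t : ℕ) :
      Continuous fun p : EuclideanSpace ℝ (Fin d) × (Fin T → EuclideanSpace ℝ (Fin d)) =>
        proxGDIter X g r η p.1 (fun s => if h : s < T then p.2 ⟨s, h⟩ else 0) t := by
    induction t with
    | zero => exact continuous_fst
    | succ t ih =>
      refine hP.comp (ih.sub (((hg.comp ih).add ?_).const_smul η))
      by_cases h : t < T
      · simp only [h, dif_pos]
        fun_prop
      · simp only [h, dif_neg, not_false_eq_true]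
        exact continuous_const
  exact continuous_pi fun t => key t

theorem lintegral_proxGDTraj_le {v p q Δ : ℝ} (hv : 0 < v) (hpq : p.HolderConjugate q)
    (hP : Continuous (proxMap X r η)) (hg : Continuous g) (hg' : Continuous g')
    (hΔ : ∀ x, ‖g x - g' x‖ ≤ Δ) (T : ℕ) (x : EuclideanSpace ℝ (Fin d))
    {φ : (Fin (T + 1) → EuclideanSpace ℝ (Fin d)) → ENNReal} (hφ : Measurable φ) :
    ∫⁻ b, φ (proxGDTraj X g r η x T b) ∂gaussNoise d T v
      ≤ ENNReal.ofReal (Real.exp ((p - 1) / (2 * v) * Δ ^ 2)) ^ T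
        * (∫⁻ b, φ (proxGDTraj X g' r η x T b) ^ q ∂gaussNoise d T v) ^ (1 / q) := by
  have hq := hpq.symm.pos
  have hp := hpq.lt
  induction T generalizing x with
  | zero =>
    have h0 (f : EuclideanSpace ℝ (Fin d) → EuclideanSpace ℝ (Fin d))
        (b : Fin 0 → EuclideanSpace ℝ (Fin d)) :
        proxGDTraj X f r η x 0 b = fun _ => x := by
      ext t : 1
      fin_cases t
      rfl
    simp [h0, ← ENNReal.rpow_mul, hq.ne']
  | succ T ih =>
    set μ := multivariateGaussian 0 (v • (1 : Matrix (Fin d) (Fin d) ℝ)) with hμ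
    set C := ENNReal.ofReal (Real.exp ((p - 1) / (2 * v) * Δ ^ 2)) with hC
    have hc := measurable_fin_cons (α := EuclideanSpace ℝ (Fin d)) (T + 1)
    have hφx : Measurable fun y => φ (Fin.cons x y) :=
      hφ.comp (hc.comp (measurable_const.prodMk measurable_id))
    have hm : ∀ {f}, Continuous f →
        Measurable fun b => φ (proxGDTraj X f r η x (T + 1) b) := fun hf =>
      hφ.comp ((continuous_proxGDTraj hP hf (T + 1)).comp
        (continuous_const.prodMk continuous_id)).measurable
    have hψ : Measurable fun a => (∫⁻ b, φ (Fin.cons x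
        (proxGDTraj X g' r η (proxMap X r η (x - η • (g' x + a))) T b)) ^ q
          ∂gaussNoise d T v) ^ (1 / q) := by
      refine Measurable.pow_const (Measurable.lintegral_prod_right'
        (f := fun p : EuclideanSpace ℝ (Fin d) × (Fin T → EuclideanSpace ℝ (Fin d)) =>
          φ (Fin.cons x
            (proxGDTraj X g' r η (proxMap X r η (x - η • (g' x + p.1))) T p.2)) ^ q) ?_) _
      refine (hφx.comp (Continuous.measurable ?_)).pow_const q
      exact (continuous_proxGDTraj hP hg' T).comp
        ((hP.comp (by fun_prop)).prodMk continuous_snd)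
    have e1 := lintegral_pi_fin_succ μ T (hm hg)
    have e2 := lintegral_pi_fin_succ μ T ((hm hg').pow_const q)
    simp only [proxGDTraj_cons] at e1 e2
    rw [gaussNoise, ← hμ, e1, e2]
    -- With the noise shifted by `g x - g' x`, both fields reach the same next iterate. The
    -- induction hypothesis compares the remaining steps from there, and the Gaussian shift bound
    -- then removes the translation.
    calc _ ≤ ∫⁻ a, C ^ T * (∫⁻ b, φ (Fin.cons x (proxGDTraj X g' r η
              (proxMap X r η (x - η • (g' x + (a + (g x - g' x))))) T b)) ^ q
                ∂gaussNoise d T v) ^ (1 / q) ∂μ := by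
          refine lintegral_mono fun a => ?_
          rw [show g' x + (a + (g x - g' x)) = g x + a by abel]
          exact ih (proxMap X r η (x - η • (g x + a))) hφx
      _ ≤ C ^ T * (C * _) := by
          refine (lintegral_const_mul _ (hψ.comp (measurable_id.add_const _))).trans_le ?_
          gcongr
          refine (lintegral_multivariateGaussian_shift_le hv hpq (g x - g' x) hψ).trans ?_
          gcongr
          exact ENNReal.ofReal_le_ofReal (Real.exp_le_exp.2
            (mul_le_mul_of_nonneg_left (by gcongr; exact hΔ x)
              (div_nonneg (by linarith) (by positivity))))
      _ = _ := by
          simp_rw [← ENNReal.rpow_mul, one_div_mul_cancel hq.ne', ENNReal.rpow_one]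
          rw [← mul_assoc, ← pow_succ]
          rfl

end Trajectory

/-- Conversion from Rényi to approximate privacy: either the left side is at most `exp (-l)`, or its
exponent exceeds `-l`, and then the first term on the right dominates it. -/
theorem exp_mul_rpow_le {p q a l x : ℝ} (hpq : p.HolderConjugate q) (hx : 0 ≤ x) :
    Real.exp ((p - 1) * a) * x ^ (1 / q)
      ≤ Real.exp (p * a + l / (p - 1)) * x + Real.exp (-l) := by
  have hp := hpq.lt
  have hq := hpq.symm.pos
  have hp1 : 0 < p - 1 := by linarith
  have hqp : 1 / q = (p - 1) / p := by
    have := hpq.inv_add_inv_eq_one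
    have hp0 : p ≠ 0 := by linarith
    field_simp at this ⊢
    linarith
  rcases hx.eq_or_lt with rfl | hx
  · rw [Real.zero_rpow (by positivity)]
    simp [Real.exp_nonneg]
  obtain ⟨u, rfl⟩ : ∃ u, x = Real.exp u := ⟨Real.log x, (Real.exp_log hx).symm⟩
  rw [← Real.exp_mul, ← Real.exp_add, ← Real.exp_add, hqp]
  rcases le_or_gt ((p - 1) * a + u * ((p - 1) / p)) (-l) with h | h
  · have := Real.exp_le_exp.2 h
    linarith [Real.exp_pos (p * a + l / (p - 1) + u)]
  · have h1 : (p - 1) * a + u * ((p - 1) / p) ≤ p * a + l / (p - 1) + u := by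
      have h2 : 0 < ((p - 1) * a + u * ((p - 1) / p) + l) / (p - 1) := div_pos (by linarith) hp1
      have h3 : p * a + l / (p - 1) + u - ((p - 1) * a + u * ((p - 1) / p))
          = ((p - 1) * a + u * ((p - 1) / p) + l) / (p - 1) := by
        field_simp
        ring
      linarith
    have := Real.exp_le_exp.2 h1
    linarith [Real.exp_pos (-l)]

theorem norm_empGrad_sub_le {d n : ℕ} {Ξ : Type*} (hn : 0 < n)
    {gradf : EuclideanSpace ℝ (Fin d) → Ξ → EuclideanSpace ℝ (Fin d)} {G : ℝ}
    {x : EuclideanSpace ℝ (Fin d)} (hG : ∀ S : Fin n → Ξ, ‖empGrad gradf S x‖ ≤ G)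
    {S S' : Fin n → Ξ} (h : ∃ i, S i ≠ S' i ∧ ∀ j, j ≠ i → S j = S' j) :
    ‖empGrad gradf S x - empGrad gradf S' x‖ ≤ 2 * G / n := by
  obtain ⟨i, -, hi⟩ := h
  have hn' : (0 : ℝ) < n := by exact_mod_cast hn
  have hsingle : ∀ ξ, ‖gradf x ξ‖ ≤ G := by
    intro ξ
    -- Only averages are assumed bounded; the constant dataset turns this into a bound for each
    -- sample.
    have := hG fun _ => ξ
    rwa [empGrad, Finset.sum_const, Finset.card_univ, Fintype.card_fin, ← Nat.cast_smul_eq_nsmul ℝ,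
      smul_smul, one_div_mul_cancel hn'.ne', one_smul] at this
  rw [empGrad, empGrad, ← smul_sub, ← Finset.sum_sub_distrib, Finset.sum_eq_single i
    (fun j _ hj => by rw [hi j hj, sub_self]) (by simp), norm_smul,
    Real.norm_of_nonneg (by positivity), mul_comm, mul_one_div]
  gcongr
  linarith [norm_sub_le (gradf x (S i)) (gradf x (S' i)), hsingle (S i), hsingle (S' i)]

/-- The noisy proximal gradient method is differentially private, with the parameters that come
from its Rényi divergence of order `p`. -/
theorem isDP_proxGDTraj {d n T : ℕ} {Ξ : Type*} (hn : 0 < n)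
    {X : Set (EuclideanSpace ℝ (Fin d))} {r : EuclideanSpace ℝ (Fin d) → ℝ}
    {gradf : EuclideanSpace ℝ (Fin d) → Ξ → EuclideanSpace ℝ (Fin d)}
    {x₀ : EuclideanSpace ℝ (Fin d)} {η L G v p l : ℝ} (hη : 0 < η) (hv : 0 < v) (hp : 1 < p)
    (hXcl : IsClosed X) (hX : Convex ℝ X) (hx₀ : x₀ ∈ X) (hr : ConvexOn ℝ Set.univ r)
    (hL : ∀ S : Fin n → Ξ, ∀ x ∈ X, ∀ y ∈ X,
      ‖empGrad gradf S x - empGrad gradf S y‖ ≤ L * ‖x - y‖)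
    (hG : ∀ S : Fin n → Ξ, ∀ x ∈ X, ‖empGrad gradf S x‖ ≤ G) :
    IsDP (gaussNoise d T v) (fun S : Fin n → Ξ => proxGDTraj X (empGrad gradf S) r η x₀ T)
      (p * (T * (2 * G / n) ^ 2 / (2 * v)) + l / (p - 1)) (Real.exp (-l)) := by
  intro S S' hSS' A hA
  have hpq := Real.HolderConjugate.conjExponent hp
  set q := p.conjExponent
  have hq := hpq.symm.pos
  have hmem := proxMap_mem hXcl ⟨x₀, hx₀⟩ hr hη
  have hP := continuous_proxMap hXcl hX ⟨x₀, hx₀⟩ hr hη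
  -- Composing with `R` gives globally continuous fields with a global sensitivity bound. The
  -- trajectories do not change, since the iterates stay in `X`.
  obtain ⟨R, hRc, hRmem, hR⟩ := exists_continuous_retraction hXcl hX ⟨x₀, hx₀⟩
  have hcont (S : Fin n → Ξ) : Continuous (empGrad gradf S ∘ R) := by
    have : ContinuousOn (empGrad gradf S) X :=
      (LipschitzOnWith.of_dist_le_mul (K := L.toNNReal) fun x hx y hy => by
        rw [dist_eq_norm, dist_eq_norm]
        refine (hL S x hx y hy).trans ?_
        gcongr
        exact Real.le_coe_toNNReal L).continuousOn
    exact this.comp_continuous hRc hRmem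
  have htraj (S : Fin n → Ξ) : proxGDTraj X (empGrad gradf S) r η x₀ T
      = proxGDTraj X (empGrad gradf S ∘ R) r η x₀ T :=
    proxGDTraj_congr hmem (fun x hx => by simp [hR x hx]) hx₀ T
  have hmeas (S : Fin n → Ξ) : Measurable (proxGDTraj X (empGrad gradf S ∘ R) r η x₀ T) :=
    ((continuous_proxGDTraj hP (hcont S) T).comp
      (continuous_const.prodMk continuous_id)).measurable
  have hint (S : Fin n → Ξ) :
      ∫⁻ b, A.indicator 1 (proxGDTraj X (empGrad gradf S ∘ R) r η x₀ T b) ∂gaussNoise d T v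
        = gaussNoise d T v {w | proxGDTraj X (empGrad gradf S) r η x₀ T w ∈ A} := by
    rw [htraj S]
    exact lintegral_indicator_one (hmeas S hA)
  have key := lintegral_proxGDTraj_le hv hpq hP (hcont S) (hcont S')
    (fun x => norm_empGrad_sub_le hn (fun S => hG S _ (hRmem x)) hSS') T x₀
    (φ := A.indicator 1) (measurable_one.indicator hA)
  -- An indicator equals its own `q`-th power, so the integral bound becomes one between
  -- probabilities.
  have hpow (y : Fin (T + 1) → EuclideanSpace ℝ (Fin d)) :
      (A.indicator 1 y : ENNReal) ^ q = A.indicator 1 y := by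
    by_cases hy : y ∈ A <;> simp [hy, hq]
  simp_rw [hpow] at key
  rw [hint, hint] at key
  refine key.trans ?_
  set P' := gaussNoise d T v {w | proxGDTraj X (empGrad gradf S') r η x₀ T w ∈ A}
  have hfin : P' ≠ ⊤ := measure_ne_top _ _
  have hreal := exp_mul_rpow_le (a := T * (2 * G / n) ^ 2 / (2 * v)) (l := l) hpq
    (ENNReal.toReal_nonneg (a := P'))
  rw [← ENNReal.ofReal_toReal hfin, ENNReal.ofReal_rpow_of_nonneg ENNReal.toReal_nonneg
    (by positivity), ← ENNReal.ofReal_pow (Real.exp_nonneg _),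
    ← ENNReal.ofReal_mul (by positivity), ← ENNReal.ofReal_mul (Real.exp_nonneg _),
    ← ENNReal.ofReal_add (by positivity) (Real.exp_nonneg _), ← Real.exp_nat_mul]
  refine ENNReal.ofReal_le_ofReal (le_of_eq_of_le ?_ hreal)
  congr 2
  ring

/-! ### Utility: telescoping and concentration of the noise. -/

/-- Pathwise bound on the averaged envelope along the trajectory. -/
theorem average_fbEnvelope_le {d T : ℕ} {X : Set (EuclideanSpace ℝ (Fin d))}
    {r F : EuclideanSpace ℝ (Fin d) → ℝ}
    {g : EuclideanSpace ℝ (Fin d) → EuclideanSpace ℝ (Fin d)} {L : ℝ}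
    {x₀ : EuclideanSpace ℝ (Fin d)} (hL : 0 < L) (hXc : IsClosed X) (hX : Convex ℝ X)
    (hx₀ : x₀ ∈ X) (hr : ConvexOn ℝ Set.univ r)
    (hF : ∀ x ∈ X, HasGradientWithinAt F (g x) X x)
    (hg : ∀ x ∈ X, ∀ y ∈ X, ‖g x - g y‖ ≤ L * ‖x - y‖)
    (hb : BddBelow ((fun y => F y + r y) '' X)) (b : Fin T → EuclideanSpace ℝ (Fin d)) :
    (1 / (T : ℝ)) * ∑ t : Fin T, fbEnvelope X g r (5 * L)
        (proxGDTraj X g r (1 / (2 * L)) x₀ T b t.castSucc)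
      ≤ (1 / (T : ℝ)) * (10 * L * optGap X F r x₀ + 5 / 2 * ∑ t, ‖b t‖ ^ 2) := by
  set β : ℕ → EuclideanSpace ℝ (Fin d) := fun s => if h : s < T then b ⟨s, h⟩ else 0 with hβ
  set x := proxGDIter X g r (1 / (2 * L)) x₀ β
  set Φ := fun y => F y + r y
  have hmem : ∀ t, x t ∈ X :=
    proxGDIter_mem (proxMap_mem hXc ⟨x₀, hx₀⟩ hr (by positivity)) hx₀ β
  have hinf : sInf (Φ '' X) ≤ Φ (x T) := csInf_le hb (Set.mem_image_of_mem _ (hmem T))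
  have hstep (t : Fin T) : fbEnvelope X g r (5 * L)
        (proxGDTraj X g r (1 / (2 * L)) x₀ T b t.castSucc)
      ≤ 10 * L * (Φ (x t) - Φ (x (t + 1))) + 5 / 2 * ‖b t‖ ^ 2 := by
    have := fbEnvelope_le_decrease hL hXc hX hr hF hg (hmem t) (x' := x (t + 1)) (b := β t) rfl
    simp only [hβ, Fin.is_lt, dif_pos] at this
    exact this
  have hsum := Finset.sum_le_sum fun t (_ : t ∈ Finset.univ) => hstep t
  rw [Finset.sum_add_distrib, ← Finset.mul_sum, ← Finset.mul_sum,
    Fin.sum_univ_eq_sum_range (fun t => Φ (x t) - Φ (x (t + 1))) T,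
    Finset.sum_range_sub'] at hsum
  refine mul_le_mul_of_nonneg_left (hsum.trans ?_) (by positivity)
  have : 10 * L * (Φ (x 0) - Φ (x T)) ≤ 10 * L * optGap X F r x₀ := by
    refine mul_le_mul_of_nonneg_left ?_ (by positivity)
    exact sub_le_sub_left hinf _
  linarith

theorem one_sub_le_gaussNoise_sum_norm_sq_le (d T : ℕ) {v β : ℝ} (hv : 0 < v) (hβ : 0 < β) :
    ENNReal.ofReal (1 - β)
      ≤ gaussNoise d T v {b | ∑ t, ‖b t‖ ^ 2 ≤ 4 * v * (d * T + Real.log (1 / β))} := by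
  set s := 4 * v * (d * T + Real.log (1 / β)) with hs
  have htail : gaussNoise d T v {b | s ≤ ∑ t, ‖b t‖ ^ 2} ≤ ENNReal.ofReal β := by
    refine (gaussNoise_sum_norm_sq_ge_le d T hv s).trans (ENNReal.ofReal_le_ofReal ?_)
    -- This crude bound suffices: the Chernoff factor is `exp (-(d * T)) * β`, which absorbs `√2 ^
    -- (d * T)`.
    have h1 : √2 ≤ Real.exp 1 := by
      rw [Real.sqrt_le_left (Real.exp_nonneg _)]
      nlinarith [Real.add_one_le_exp (1 : ℝ)]
    have h2 : √2 ^ (d * T) ≤ Real.exp (d * T) := by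
      have := pow_le_pow_left₀ (Real.sqrt_nonneg 2) h1 (d * T)
      rwa [← Real.exp_nat_mul, mul_one, Nat.cast_mul] at this
    refine (mul_le_mul_of_nonneg_right h2 (Real.exp_nonneg _)).trans_eq ?_
    rw [← Real.exp_add, hs, mul_div_cancel_left₀ _ (by positivity), neg_add_rev,
      add_neg_cancel_comm_assoc, one_div, Real.log_inv, neg_neg, Real.exp_log hβ]
  have hmeas : MeasurableSet {b : Fin T → EuclideanSpace ℝ (Fin d) | s ≤ ∑ t, ‖b t‖ ^ 2} :=
    measurableSet_le measurable_const (by fun_prop)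
  refine le_trans ?_ (measure_mono (s := {b | s ≤ ∑ t, ‖b t‖ ^ 2}ᶜ) fun b hb => ?_)
  · rw [prob_compl_eq_one_sub hmeas, ENNReal.ofReal_sub _ hβ.le, ENNReal.ofReal_one]
    exact tsub_le_tsub_left htail 1
  · have hb' : ¬ s ≤ ∑ t, ‖b t‖ ^ 2 := hb
    exact (not_le.1 hb').le

/-! ### Arithmetic of the parameters. -/

theorem noiseVar_pos {c G ε δ : ℝ} {n T : ℕ} (hc : 0 < c) (hG : 0 < G) (hε : 0 < ε)
    (hδ : 0 < δ) (hδ1 : δ < 1) (hn : 0 < n) (hT : 1 ≤ T) : 0 < noiseVar c G ε δ n T := by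
  have h1 : 0 < Real.log (1 / δ) := Real.log_pos (one_lt_one_div hδ hδ1)
  have hn' : (0 : ℝ) < n := by exact_mod_cast hn
  have hT' : (0 : ℝ) < T := by exact_mod_cast hT
  unfold noiseVar
  positivity

/-- The order `p = 1 + 2 log(1/δ)/ε` makes the conversion cost exactly `ε/2`; the constant `4c₁ + 8`
makes the composition cost at most `ε/2`, by `ε ≤ c₁ log(1/δ)`. -/
theorem privacy_param_le {c₁ G ε δ : ℝ} {n T : ℕ} (hc : 0 < c₁) (hG : 0 < G) (hε : 0 < ε)
    (hδ : 0 < δ) (hδ1 : δ < 1) (hn : 0 < n) (hT : 1 ≤ T) (h : ε ≤ c₁ * Real.log (1 / δ)) :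
    (1 + 2 * Real.log (1 / δ) / ε) * (T * (2 * G / n) ^ 2
        / (2 * noiseVar (4 * c₁ + 8) G ε δ n T))
      + Real.log (1 / δ) / (1 + 2 * Real.log (1 / δ) / ε - 1) ≤ ε := by
  have hl : 0 < Real.log (1 / δ) := Real.log_pos (one_lt_one_div hδ hδ1)
  have hn' : (0 : ℝ) < n := by exact_mod_cast hn
  have hT' : (0 : ℝ) < T := by exact_mod_cast hT
  set l := Real.log (1 / δ) with hl_def
  have e1 : T * (2 * G / n) ^ 2 / (2 * noiseVar (4 * c₁ + 8) G ε δ n T)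
      = 2 * ε ^ 2 / ((4 * c₁ + 8) * l) := by
    rw [noiseVar, ← hl_def]
    field_simp
  have e2 : l / (1 + 2 * l / ε - 1) = ε / 2 := by
    rw [add_sub_cancel_left]
    field_simp
  have e3 : (1 + 2 * l / ε) * (2 * ε ^ 2 / ((4 * c₁ + 8) * l))
      = ε / 2 * ((ε + 2 * l) / (c₁ * l + 2 * l)) := by
    field_simp
    ring
  have h4 : (ε + 2 * l) / (c₁ * l + 2 * l) ≤ 1 := (div_le_one (by positivity)).2 (by linarith)
  rw [e1, e2, e3]
  nlinarith

/-- With `A` the target rate and `τ` the unrounded iteration count: `A τ = Lλ₀` and `σ² d log(1/β) τ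
= c T A`. The product form also covers `λ₀ = 0`, where `A = τ = 0`. -/
theorem rate_mul_iterations {c G ε δ β L lam₀ : ℝ} {d n T : ℕ} (hd : 0 < d)
    (hn : 0 < n) (hL : 0 < L) (hG : 0 < G) (hε : 0 < ε) (hδ : 0 < δ) (hδ1 : δ < 1) (hβ : 0 < β)
    (hβ1 : β < 1) (hlam : 0 ≤ lam₀) :
    G * √(L * lam₀ * d * Real.log (1 / δ) * Real.log (1 / β)) / (n * ε)
        * (n * ε * √(L * lam₀) / (G * √(d * Real.log (1 / δ) * Real.log (1 / β)))) = L * lam₀ ∧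
      noiseVar c G ε δ n T * d * Real.log (1 / β)
        * (n * ε * √(L * lam₀) / (G * √(d * Real.log (1 / δ) * Real.log (1 / β))))
      = c * T * (G * √(L * lam₀ * d * Real.log (1 / δ) * Real.log (1 / β)) / (n * ε)) := by
  have hl : 0 < Real.log (1 / δ) := Real.log_pos (one_lt_one_div hδ hδ1)
  have hm : 0 < Real.log (1 / β) := Real.log_pos (one_lt_one_div hβ hβ1)
  have hn' : (0 : ℝ) < n := by exact_mod_cast hn
  have hd' : (0 : ℝ) < d := by exact_mod_cast hd
  rw [noiseVar]
  set l := Real.log (1 / δ)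
  set m := Real.log (1 / β)
  have hs : √(L * lam₀) ^ 2 = L * lam₀ := Real.sq_sqrt (by positivity)
  have hD : √(d * l * m) ^ 2 = d * l * m := Real.sq_sqrt (by positivity)
  have hD0 : 0 < √(d * l * m) := Real.sqrt_pos.2 (by positivity)
  have hsD : √(L * lam₀ * d * l * m) = √(L * lam₀) * √(d * l * m) := by
    rw [← Real.sqrt_mul (by positivity)]
    congr 1
    ring
  rw [hsD]
  set s := √(L * lam₀)
  set D := √(d * l * m)
  constructor
  · field_simp
    exact hs
  · field_simp
    rw [hD]
    ring

/-- The claimed rate when the number of iterations is the balancing value up to rounding, and is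
one. -/
theorem rate_comparison_one {c G ε δ β βmax L lam₀ : ℝ} {d n : ℕ} (hc : 0 < c) (hd : 0 < d)
    (hn : 0 < n) (hL : 0 < L) (hG : 0 < G) (hε : 0 < ε) (hδ : 0 < δ) (hδ1 : δ < 1) (hβ : 0 < β)
    (hβm : β ≤ βmax) (hβ1 : βmax < 1) (hlam : 0 ≤ lam₀)
    (hτ : |1 - n * ε * √(L * lam₀) / (G * √(d * Real.log (1 / δ) * Real.log (1 / β)))| ≤ 1) :
    10 * L * lam₀ ≤ (20 + 20 * c * (1 / Real.log (1 / βmax) + 1))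
        * (G * √(L * lam₀ * d * Real.log (1 / δ) * Real.log (1 / β)) / (n * ε)) := by
  have h1 := (rate_mul_iterations (c := c) (T := 1) hd hn hL hG hε hδ hδ1 hβ
    (hβm.trans_lt hβ1) hlam).1
  have hm0 : 0 < Real.log (1 / βmax) := Real.log_pos (one_lt_one_div (hβ.trans_le hβm) hβ1)
  set A := G * √(L * lam₀ * d * Real.log (1 / δ) * Real.log (1 / β)) / (n * ε)
  have hA : 0 ≤ A := by positivity
  set τ := n * ε * √(L * lam₀) / (G * √(d * Real.log (1 / δ) * Real.log (1 / β)))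
  have hτ2 : τ ≤ 2 := by linarith [(abs_le.1 hτ).1]
  have h2 : A * τ ≤ A * 2 := mul_le_mul_of_nonneg_left hτ2 hA
  have h3 : 0 ≤ 20 * c * (1 / Real.log (1 / βmax) + 1) * A := by positivity
  linarith

/-- The claimed rate when the number of iterations is the balancing value up to rounding, and is
at least two. -/
theorem rate_comparison {c G ε δ β βmax L lam₀ : ℝ} {d n T : ℕ} (hc : 0 < c) (hd : 0 < d)
    (hn : 0 < n) (hL : 0 < L) (hG : 0 < G) (hε : 0 < ε) (hδ : 0 < δ) (hδ1 : δ < 1) (hβ : 0 < β)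
    (hβm : β ≤ βmax) (hβ1 : βmax < 1) (hlam : 0 ≤ lam₀) (hT : 2 ≤ T)
    (hτ : |(T : ℝ) - n * ε * √(L * lam₀) / (G * √(d * Real.log (1 / δ) * Real.log (1 / β)))| ≤ 1) :
    (1 / (T : ℝ)) * (10 * L * lam₀
        + 5 / 2 * (4 * noiseVar c G ε δ n T * (d * T + Real.log (1 / β))))
      ≤ (20 + 20 * c * (1 / Real.log (1 / βmax) + 1))
        * (G * √(L * lam₀ * d * Real.log (1 / δ) * Real.log (1 / β)) / (n * ε)) := by
  obtain ⟨h1, h2⟩ := rate_mul_iterations (c := c) (T := T) hd hn hL hG hε hδ hδ1 hβ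
    (hβm.trans_lt hβ1) hlam
  have hv := noiseVar_pos (T := T) hc hG hε hδ hδ1 hn (by omega)
  have hm0 : 0 < Real.log (1 / βmax) := Real.log_pos (one_lt_one_div (hβ.trans_le hβm) hβ1)
  have hm : Real.log (1 / βmax) ≤ Real.log (1 / β) :=
    Real.log_le_log (by have := hβ.trans_le hβm; positivity) (one_div_le_one_div_of_le hβ hβm)
  have hT' : (2 : ℝ) ≤ T := by exact_mod_cast hT
  have hd' : (1 : ℝ) ≤ d := by exact_mod_cast hd
  set A := G * √(L * lam₀ * d * Real.log (1 / δ) * Real.log (1 / β)) / (n * ε)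
  have hA : 0 ≤ A := by positivity
  set τ := n * ε * √(L * lam₀) / (G * √(d * Real.log (1 / δ) * Real.log (1 / β)))
  set v := noiseVar c G ε δ n T
  set m := Real.log (1 / β)
  set m₀ := Real.log (1 / βmax)
  obtain ⟨hτ1, hτ2⟩ := abs_le.1 hτ
  have hT0 : (0 : ℝ) < T := by linarith
  have hmpos : 0 < m := by linarith
  have hw : 0 ≤ v * d * m := by positivity
  -- Rounding costs a factor two on each side: `τ ≤ T + 1 ≤ 2T` here, and `τ ≥ T - 1 ≥ T/2` in `h4`.
  -- The latter needs `T ≥ 2`.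
  have h3 : 10 * L * lam₀ ≤ 20 * A * T := by
    have : A * τ ≤ A * (2 * T) := mul_le_mul_of_nonneg_left (by linarith) hA
    linarith
  have h4 : v * d * m ≤ 2 * c * A := by
    have h5 : v * d * m * (T / 2) ≤ c * T * A := by
      rw [← h2]
      exact mul_le_mul_of_nonneg_left (by linarith) hw
    refine le_of_mul_le_mul_right ?_ (half_pos hT0)
    linarith
  -- The bound on `β` keeps `log(1/β)` away from zero, so `d * T` can be charged to `d * T *
  -- log(1/β)` at the price `1 / m₀`.
  have h6 : v * (d * T + m) ≤ v * d * m * (1 / m₀ + 1) * T := by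
    have h7 : 1 ≤ m * (1 / m₀) := by
      rw [mul_one_div]
      exact (one_le_div hm0).2 hm
    have h8 : d * T * 1 ≤ d * T * (m * (1 / m₀)) :=
      mul_le_mul_of_nonneg_left h7 (by positivity)
    have h9 : m * 1 ≤ m * (d * T) := mul_le_mul_of_nonneg_left (by nlinarith) hmpos.le
    have h10 : v * (d * T + m) ≤ v * (d * T * (m * (1 / m₀)) + m * (d * T)) :=
      mul_le_mul_of_nonneg_left (by linarith) hv.le
    linarith
  have h11 : v * d * m * ((1 / m₀ + 1) * T) ≤ 2 * c * A * ((1 / m₀ + 1) * T) :=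
    mul_le_mul_of_nonneg_right h4 (by positivity)
  rw [one_div_mul_eq_div, div_le_iff₀ hT0]
  linarith

/-! ### Assembly. -/

theorem mainTheorem7 (c₁ : ℝ) (hc₁ : 0 < c₁) :
    ∃ c₂ : ℝ, 0 < c₂ ∧ ∀ βmax : ℝ, 0 < βmax → βmax < 1 → ∃ K : ℝ, 0 < K ∧
    ∀ (d n : ℕ) (Ξ : Type*) (X : Set (EuclideanSpace ℝ (Fin d)))
      (f : EuclideanSpace ℝ (Fin d) → Ξ → ℝ)
      (gradf : EuclideanSpace ℝ (Fin d) → Ξ → EuclideanSpace ℝ (Fin d))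
      (r : EuclideanSpace ℝ (Fin d) → ℝ) (x₀ : EuclideanSpace ℝ (Fin d))
      (L G ε δ β lam₀ : ℝ) (T : ℕ),
    0 < d → 0 < n → IsClosed X → Convex ℝ X → x₀ ∈ X → ConvexOn ℝ Set.univ r →
    LowerSemicontinuous r →
    0 < L → 0 < G →
    -- for every dataset, the empirical loss is differentiable on `X`, with an `L`-Lipschitz
    -- gradient of norm at most `G`
    (∀ S : Fin n → Ξ, ∀ x ∈ X, HasGradientWithinAt (empLoss f S) (empGrad gradf S x) X x) →
    (∀ S : Fin n → Ξ, ∀ x ∈ X, ∀ y ∈ X,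
      ‖empGrad gradf S x - empGrad gradf S y‖ ≤ L * ‖x - y‖) →
    (∀ S : Fin n → Ξ, ∀ x ∈ X, ‖empGrad gradf S x‖ ≤ G) →
    0 < ε → 0 < δ → δ < 1 → ε ≤ c₁ * Real.log (1 / δ) →
    0 < β → β ≤ βmax → 0 ≤ lam₀ →
    -- the number of iterations, rounded to a positive integer
    1 ≤ T →
    |(T : ℝ) - n * ε * √(L * lam₀) / (G * √(d * Real.log (1 / δ) * Real.log (1 / β)))| ≤ 1 →
    IsDP (gaussNoise d T (noiseVar c₂ G ε δ n T))
      (fun S : Fin n → Ξ => proxGDTraj X (empGrad gradf S) r (1 / (2 * L)) x₀ T) ε δ ∧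
    ∀ S : Fin n → Ξ, BddBelow ((fun y => empLoss f S y + r y) '' X) →
      optGap X (empLoss f S) r x₀ ≤ lam₀ →
      ENNReal.ofReal (1 - β) ≤ gaussNoise d T (noiseVar c₂ G ε δ n T)
        {b | (1 / (T : ℝ)) * ∑ t : Fin T, fbEnvelope X (empGrad gradf S) r (5 * L)
              (proxGDTraj X (empGrad gradf S) r (1 / (2 * L)) x₀ T b t.castSucc)
            ≤ K * (G * √(L * lam₀ * d * Real.log (1 / δ) * Real.log (1 / β)) / (n * ε))} := by
  refine ⟨4 * c₁ + 8, by positivity, fun βmax hβm0 hβm1 =>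
    ⟨20 + 20 * (4 * c₁ + 8) * (1 / Real.log (1 / βmax) + 1), ?_, ?_⟩⟩
  · have := Real.log_pos (one_lt_one_div hβm0 hβm1)
    positivity
  intro d n Ξ X f gradf r x₀ L G ε δ β lam₀ T hd hn hXc hX hx₀ hr _ hL hG hF hLip hbd hε hδ hδ1
    hεδ hβ hβm hlam hT hτ
  have hl : 0 < Real.log (1 / δ) := Real.log_pos (one_lt_one_div hδ hδ1)
  have hv := noiseVar_pos (c := 4 * c₁ + 8) (by positivity) hG hε hδ hδ1 hn hT
  constructor
  · intro S S' hSS' A hA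
    have hp : 0 < 2 * Real.log (1 / δ) / ε := by positivity
    have hDP := isDP_proxGDTraj (T := T) (η := 1 / (2 * L)) (p := 1 + 2 * Real.log (1 / δ) / ε)
      (l := Real.log (1 / δ)) hn (by positivity) hv (by linarith) hXc hX hx₀ hr hLip hbd S S' hSS' A hA
    refine hDP.trans (add_le_add ?_ (ENNReal.ofReal_le_ofReal ?_))
    · gcongr
      exact privacy_param_le hc₁ hG hε hδ hδ1 hn hT hεδ
    · rw [one_div, Real.log_inv, neg_neg, Real.exp_log hδ]
  · intro S hb hgap
    have hT' : (0 : ℝ) < T := by exact_mod_cast hT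
    -- For `T = 1` the count `τ` may be near `0` and give no control of the noise; the average is
    -- then just the envelope at `x₀`, and the bound holds for every `b`.
    rcases hT.eq_or_lt with rfl | hT2
    · refine (ENNReal.ofReal_le_one.2 (by linarith)).trans ?_
      rw [← measure_univ (μ := gaussNoise d 1 (noiseVar (4 * c₁ + 8) G ε δ n 1))]
      refine measure_mono fun b _ => ?_
      refine le_trans ?_ (rate_comparison_one (by positivity) hd hn hL hG hε hδ hδ1 hβ hβm hβm1
        hlam (by simpa using hτ))
      have h1 := fbEnvelope_le_optGap hL hX (hF S) (hLip S) hb hx₀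
      have h2 : 10 * L * optGap X (empLoss f S) r x₀ ≤ 10 * L * lam₀ := by gcongr
      simpa [proxGDTraj, proxGDIter] using h1.trans h2
    · refine (one_sub_le_gaussNoise_sum_norm_sq_le d T hv hβ).trans
        (measure_mono fun b hbs => ?_)
      refine (average_fbEnvelope_le hL hXc hX hx₀ hr (hF S) (hLip S) hb b).trans
        (le_trans ?_ (rate_comparison (by positivity) hd hn hL hG hε hδ hδ1 hβ hβm hβm1 hlam hT2
          hτ))
      have : ∑ t, ‖b t‖ ^ 2 ≤ _ := hbs
      gcongr
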